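/- Let $X,U$ be complex Banach spaces, let $A$ generate a $C_0$-semigroup $\{S(t)\}_{t\ge 0}$ on $X$, let $\sigma$ be the spectrum of $A$ and fix $\mu\in\mathbb C\setminus\sigma$. Let $V\supseteq X$ be the completion of $X$ in the norm $\|x\|_{-\mu}=\|(\mu I-A)^{-1}x\|$, and let $\mathcal S(t):V\to V$ be the extension of $S(t)$ by continuity. Let $B:U\to V$ be bounded and linear ($B$ may be unbounded as an operator into $X$), and suppose that for every $t\ge 0$ the operator $\Phi(t)u=\int_0^t\mathcal S(t-\tau)Bu(\tau)\,d\tau$ is bounded from $L_2([0,t],U)$ to $X$. For $t\ge 0$ let $K(t)=\{\Phi(t)u:\ u\in L_2([0,t],U)\}\subseteq X$ be the set of states attainable from the origin in time $t$ for $\dot x=Ax+Bu$. **Theorem 1.** If $0\le t_1\le t_2$, then $K(t_1)\subseteq K(t_2)$. Moreover, let $T\ge 0$ and $\nu>0$ and suppose: (I) the domain $D(A^*)$ of the adjoint is dense in $X^*$; (II) $\sigma$ consists of eigenvalues, is either finite or has no finite limit points, and each $\lambda\in\sigma$ has a finite multiplicity $\alpha_\lambda$ (the dimension of the generalized eigenspace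 $\bigcup_n\ker(A-\lambda I)^n$); (III) for every $v\in V$ and $t>T$ the function $\mathcal S(t)v$ is the sum of a series $\sum_{\lambda\in\sigma}y_\lambda(t)$ with $y_\lambda(t)$ in the generalized eigenspace of $A$ at $\lambda$; for a certain grouping of the terms into finite groups, the series converges in the norm of $V$ uniformly with respect to $t$ on every $[T_1,T_2]$ with $T_1>T$; and suppose that the functions $f_{\lambda k}(t)=(-t)^k e^{-\lambda t}$, $\lambda\in\sigma$, $k=0,\dots,\alpha_\lambda-1$, are minimal on $[0,\nu]$, that is, there are $y_{\lambda k}\in L_2[0,\nu]$ with $\int_0^\nu f_{\lambda k}(t)\,y_{\lambda' k'}(t)\,dt=1$ if $(\lambda,k)=(\lambda',k')$ and $=0$ otherwise. Then $\overline{K(t_1)}=\overline{K(t_2)}$ (closures in $X$) for all $t_1,t_2>T+\nu$. -/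

import Mathlib

open MeasureTheory Filter Topology

noncomputable section

namespace AbstractControl

variable {X U : Type*} [NormedAddCommGroup X] [NormedSpace ℂ X]
  [NormedAddCommGroup U] [NormedSpace ℂ U]

/-! ### Semigroups and unbounded operators -/

/-- `S` is a strongly continuous (`C₀`) semigroup; only the values `S t` with `0 ≤ t` matter. -/
structure IsC0Semigroup (S : ℝ → X →L[ℂ] X) : Prop where
  map_zero : S 0 = ContinuousLinearMap.id ℂ X
  map_add : ∀ s t : ℝ, 0 ≤ s → 0 ≤ t → S (s + t) = (S s).comp (S t)
  tendsto_zero : ∀ x : X, Tendsto (fun t : ℝ => S t x) (𝓝[>] 0) (𝓝 x)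

/-- `A` is the infinitesimal generator of `S`: `x ∈ D(A)` and `A x = y` if and only if
`(S h x - x) / h → y` as `h ↓ 0`. -/
def IsGenerator (A : X →ₗ.[ℂ] X) (S : ℝ → X →L[ℂ] X) : Prop :=
  ∀ x y : X, (x, y) ∈ A.graph ↔
    Tendsto (fun h : ℝ => (h : ℂ)⁻¹ • (S h x - x)) (𝓝[>] 0) (𝓝 y)

/-- `R` is the bounded two-sided inverse `(μ I - A)⁻¹`. -/
def IsResolventAt (A : X →ₗ.[ℂ] X) (μ : ℂ) (R : X →L[ℂ] X) : Prop :=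
  (∀ x : X, ∃ h : R x ∈ A.domain, μ • R x - A ⟨R x, h⟩ = x) ∧
    ∀ x : A.domain, R (μ • (x : X) - A x) = x

/-- The spectrum `σ` of the operator `A`. -/
def spectrumOf (A : X →ₗ.[ℂ] X) : Set ℂ :=
  {l | ¬ ∃ R : X →L[ℂ] X, IsResolventAt A l R}

/-- `ker (A - l I)ⁿ` (with the natural domain of the power). -/
def kerPow (A : X →ₗ.[ℂ] X) (l : ℂ) : ℕ → Submodule ℂ X
  | 0 => ⊥
  | n + 1 => ((kerPow A l n).comap (A.toFun - l • A.domain.subtype)).map A.domain.subtype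

/-- The generalized eigenspace of `A` at `l`: the union of all `ker (A - l I)ⁿ`. -/
def genEigenspace (A : X →ₗ.[ℂ] X) (l : ℂ) : Submodule ℂ X :=
  ⨆ n : ℕ, kerPow A l n

/-- The (algebraic) multiplicity of `l`. -/
def multiplicity (A : X →ₗ.[ℂ] X) (l : ℂ) : ℕ :=
  Module.finrank ℂ (genEigenspace A l)

/-- The domain `D(A*) ⊆ X*` of the adjoint operator: the functionals `f` for which there is
`g ∈ X*` (namely `g = A* f`) with `f (A x) = g x` on `D(A)`. -/
def adjointDomain (A : X →ₗ.[ℂ] X) : Set (X →L[ℂ] ℂ) :=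
  {f | ∃ g : X →L[ℂ] ℂ, ∀ x : A.domain, f (A x) = g x}

/-! ### The extrapolation space `V` -/

/-- The space `X`, to be given the norm `‖R x‖`. -/
def PreExtrapolation (_R : X →L[ℂ] X) : Type _ := X

instance (R : X →L[ℂ] X) : AddCommGroup (PreExtrapolation R) :=
  inferInstanceAs (AddCommGroup X)

instance (R : X →L[ℂ] X) : Module ℂ (PreExtrapolation R) :=
  inferInstanceAs (Module ℂ X)

/-- The operator `R`, as a linear map on the copy of `X`. -/
def PreExtrapolation.lin (R : X →L[ℂ] X) : PreExtrapolation R →ₗ[ℂ] X := R.toLinearMap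

instance (R : X →L[ℂ] X) : SeminormedAddCommGroup (PreExtrapolation R) :=
  SeminormedAddCommGroup.induced (PreExtrapolation R) X (PreExtrapolation.lin R)

instance (R : X →L[ℂ] X) : NormedSpace ℂ (PreExtrapolation R) :=
  NormedSpace.induced ℂ (PreExtrapolation R) X (PreExtrapolation.lin R)

/-- For `R = (μ I - A)⁻¹`, the space `V`: the completion of `X` in the norm
`‖x‖_{-μ} = ‖(μ I - A)⁻¹ x‖`. -/
abbrev Extrapolation (R : X →L[ℂ] X) : Type _ :=
  UniformSpace.Completion (PreExtrapolation R)

/-- The embedding `X ⊆ V`. -/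
def toV (R : X →L[ℂ] X) : X →ₗ[ℂ] Extrapolation R :=
  (UniformSpace.Completion.toComplL : PreExtrapolation R →L[ℂ] Extrapolation R).toLinearMap

theorem norm_toV (R : X →L[ℂ] X) (x : X) : ‖toV R x‖ = ‖R x‖ :=
  UniformSpace.Completion.norm_coe (E := PreExtrapolation R) x

theorem denseRange_toV (R : X →L[ℂ] X) : DenseRange (toV R) :=
  UniformSpace.Completion.denseRange_coe (α := PreExtrapolation R)

/-- The extension by continuity of a bounded operator `L` on `X` to an operator on `V`. -/
def extendToV (R L : X →L[ℂ] X) : Extrapolation R → Extrapolation R :=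
  UniformSpace.Completion.map
    (fun x : PreExtrapolation R => (show PreExtrapolation R from L (show X from x)))

theorem uniformContinuous_pre {R L : X →L[ℂ] X} (h : ∀ x, R (L x) = L (R x)) :
    UniformContinuous
      (fun x : PreExtrapolation R => (show PreExtrapolation R from L (show X from x))) := by
  let L' : PreExtrapolation R →ₗ[ℂ] PreExtrapolation R := L.toLinearMap
  have hb : ∀ x : PreExtrapolation R, ‖L' x‖ ≤ ‖L‖ * ‖x‖ := by
    intro x
    change ‖R (L (show X from x))‖ ≤ ‖L‖ * ‖R (show X from x)‖
    rw [h]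
    exact L.le_opNorm _
  exact (L'.mkContinuous ‖L‖ hb).uniformContinuous

/-- If `L` commutes with `R`, then the extension is continuous and agrees with `L` on `X`. -/
theorem extendToV_toV {R L : X →L[ℂ] X} (h : ∀ x, R (L x) = L (R x)) :
    Continuous (extendToV R L) ∧ ∀ x : X, extendToV R L (toV R x) = toV R (L x) :=
  ⟨UniformSpace.Completion.continuous_map, fun x =>
    UniformSpace.Completion.map_coe (α := PreExtrapolation R) (β := PreExtrapolation R)
      (uniformContinuous_pre h) x⟩

/-- The resolvent of the generator commutes with the semigroup, so the previous fact applies to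
`L = S t`. -/
theorem resolvent_comm {S : ℝ → X →L[ℂ] X} (hS : IsC0Semigroup S) {A : X →ₗ.[ℂ] X}
    (hA : IsGenerator A S) {μ : ℂ} {R : X →L[ℂ] X} (hR : IsResolventAt A μ R)
    {t : ℝ} (ht : 0 ≤ t) (z : X) : R (S t z) = S t (R z) := by
  obtain ⟨hz, hz'⟩ := hR.1 z
  have hg : (R z, A ⟨R z, hz⟩) ∈ A.graph := A.mem_graph ⟨R z, hz⟩
  have h1 := ((S t).continuous.tendsto _).comp ((hA _ _).1 hg)
  have h2 : (S t (R z), S t (A ⟨R z, hz⟩)) ∈ A.graph := by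
    refine (hA _ _).2 (h1.congr' ?_)
    filter_upwards [self_mem_nhdsWithin] with h (hh : 0 < h)
    have e : S h (S t (R z)) = S t (S h (R z)) := by
      have e1 := congrArg (fun L => L (R z)) (hS.map_add h t hh.le ht)
      have e2 := congrArg (fun L => L (R z)) (hS.map_add t h ht hh.le)
      rw [add_comm] at e2
      exact e1.symm.trans e2
    simp [e]
  obtain ⟨y, hy1, hy2⟩ := (LinearPMap.mem_graph_iff A).1 h2
  dsimp only at hy1 hy2
  have h3 := hR.2 y
  rw [hy2, hy1, ← map_smul, ← map_sub, hz'] at h3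
  exact h3

/-- The semigroup `𝒮(t)` on `V` that extends `S(t)` by continuity. -/
def semigroupV (R : X →L[ℂ] X) (S : ℝ → X →L[ℂ] X) (t : ℝ) : Extrapolation R → Extrapolation R :=
  extendToV R (S t)

/-! ### The control system `x' = A x + B u`, `B : U → V` bounded -/

/-- The space `L₂([0,t], U)` of controls. -/
abbrev Control (U : Type*) [NormedAddCommGroup U] (t : ℝ) : Type _ :=
  Lp U 2 (volume.restrict (Set.Icc (0 : ℝ) t))

/-- `Φ(t) u = ∫₀ᵗ 𝒮(t - τ) B u(τ) dτ`, an integral in `V`. -/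
def inputMap (R : X →L[ℂ] X) (S : ℝ → X →L[ℂ] X) (B : U →L[ℂ] Extrapolation R)
    (t : ℝ) (u : Control U t) : Extrapolation R :=
  ∫ τ in (0 : ℝ)..t, semigroupV R S (t - τ) (B (u τ))

/-- The operator `Φ(t)` is bounded from `L₂([0,t], U)` to `X`, for each `t ≥ 0`. -/
def IsAdmissible (R : X →L[ℂ] X) (S : ℝ → X →L[ℂ] X) (B : U →L[ℂ] Extrapolation R) : Prop :=
  ∀ t : ℝ, 0 ≤ t → ∃ Φ : Control U t →L[ℂ] X,
    ∀ u : Control U t, toV R (Φ u) = inputMap R S B t u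

/-- The value `x(t, x₀, u)` of the weak solution. -/
def weakSolution (R : X →L[ℂ] X) (S : ℝ → X →L[ℂ] X) (B : U →L[ℂ] Extrapolation R)
    (t : ℝ) (x₀ : X) (u : Control U t) : Extrapolation R :=
  toV R (S t x₀) + inputMap R S B t u

/-- The attainable set `K(t)`: the states attainable from the origin in the time `t`. -/
def attainableSet (R : X →L[ℂ] X) (S : ℝ → X →L[ℂ] X) (B : U →L[ℂ] Extrapolation R)
    (t : ℝ) : Set X :=
  {x | ∃ u : Control U t, toV R x = weakSolution R S B t 0 u}

/-! ### Properties (I)-(III) and minimality -/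

/-- (I): the domain of `A*` is dense in `X*`. -/
def PropertyI (A : X →ₗ.[ℂ] X) : Prop := Dense (adjointDomain A)

/-- (II): the spectrum consists of eigenvalues of finite multiplicity and has no finite limit
points (in particular it may be finite). -/
def PropertyII (A : X →ₗ.[ℂ] X) : Prop :=
  (∀ l ∈ spectrumOf A, ∃ x : A.domain, (x : X) ≠ 0 ∧ A x = l • (x : X)) ∧
  (∀ z : ℂ, ¬ AccPt z (𝓟 (spectrumOf A))) ∧
  ∀ l ∈ spectrumOf A, FiniteDimensional ℂ (genEigenspace A l)

/-- (III): for every `v ∈ V` and `t > T` the function `𝒮(t) v` is the sum of a series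
`∑_{l ∈ σ} y_l(t)` whose terms are generalized eigenvectors of `A` (`y_l(t)` belongs to the
generalized eigenspace at `l`). The series converges in the norm of `V`, after grouping, uniformly
on every `[T₁, T₂]` with `T₁ > T`. The grouping is given by the union `F n` of the first `n` of its
finite groups. -/
def PropertyIII (A : X →ₗ.[ℂ] X) (R : X →L[ℂ] X) (S : ℝ → X →L[ℂ] X) (T : ℝ) : Prop :=
  ∀ v : Extrapolation R,
    ∃ (y : spectrumOf A → ℝ → X) (F : ℕ → Finset (spectrumOf A)),
      (∀ (l : spectrumOf A) (t : ℝ), y l t ∈ genEigenspace A (l : ℂ)) ∧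
      Monotone F ∧ (∀ l : spectrumOf A, ∃ n, l ∈ F n) ∧
      ∀ T₁ T₂ : ℝ, T < T₁ → T₁ ≤ T₂ →
        TendstoUniformlyOn (fun n t => ∑ l ∈ F n, toV R (y l t))
          (fun t => semigroupV R S t v) atTop (Set.Icc T₁ T₂)

/-- The family `f` is minimal on `[0, ν]`: it has a biorthogonal family in `L₂[0, ν]`. -/
def IsMinimalOn {ι : Type*} (f : ι → ℝ → ℂ) (ν : ℝ) : Prop :=
  ∃ y : ι → ℝ → ℂ, (∀ j, MemLp (y j) 2 (volume.restrict (Set.Icc (0 : ℝ) ν))) ∧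
    (∀ i, ∫ t in (0 : ℝ)..ν, f i t * y i t = 1) ∧
    ∀ i j, i ≠ j → ∫ t in (0 : ℝ)..ν, f i t * y j t = 0

/-- The functions `(-t)^k exp (-l t)`, where `l` runs over the spectrum and `k` takes as many
values `0, 1, …` as the multiplicity of `l`. -/
def expFamily (A : X →ₗ.[ℂ] X) :
    (Σ l : spectrumOf A, Fin (multiplicity A (l : ℂ))) → ℝ → ℂ :=
  fun p t => (-(t : ℂ)) ^ (p.2 : ℕ) * Complex.exp (-(p.1 : ℂ) * (t : ℂ))

end AbstractControl

end

/-! The resolvent extends to an isometry J from V into X that intertwines the two semigroups. With b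
= JB, a bounded operator from U to X, a state x lies in K(t) iff Rx = ∫₀ᵗ S(t-τ)b w(τ)dτ for some
control w (`mem_attainableSet_iff`), so everything takes place in X. Delaying a control gives
monotonicity; switching it off early gives S(s)K(t) ⊆ K(t+s).

For the closures, let f ∈ X* vanish on K(t₁). For small r the average of f∘S(s) over [0,r] factors
as g∘R with g ∈ X*, and it vanishes on K(t), t = t₁-r > T+ν. Testing with suitable controls gives
g(S(s)bβ) = 0 on [0,t]. Since t-ν > T, the orbit expands at time t-ν in generalized eigenvectors,
and g applied to the terms gives exponential polynomials whose grouped sums tend to 0 uniformly on a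
window of length ν. Minimality kills every term (`eq_zero_of_tendstoUniformlyOn_expFamily`), so
g(S(s)bβ) = 0 for all s ≥ 0 and g∘R vanishes on every K(t₂). Letting r → 0 gives f = 0 on K(t₂), and
Hahn–Banach concludes. -/

namespace AbstractControl

variable {X U : Type*} [NormedAddCommGroup X] [NormedSpace ℂ X]
  [NormedAddCommGroup U] [NormedSpace ℂ U]

/-! ### Local boundedness and continuity of a C₀-semigroup. -/

section Semigroup

variable {S : ℝ → X →L[ℂ] X}

theorem IsC0Semigroup.apply_add (hS : IsC0Semigroup S) {s t : ℝ} (hs : 0 ≤ s) (ht : 0 ≤ t)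
    (x : X) : S (s + t) x = S s (S t x) := by
  rw [hS.map_add s t hs ht, ContinuousLinearMap.comp_apply]

theorem IsC0Semigroup.apply_zero (hS : IsC0Semigroup S) (x : X) : S 0 x = x := by
  rw [hS.map_zero, ContinuousLinearMap.id_apply]

/-- Nothing is assumed about `S` at negative times; inserting |t| gives orbits defined and
continuous on all of ℝ. -/
theorem IsC0Semigroup.tendsto_abs_zero (hS : IsC0Semigroup S) (x : X) :
    Tendsto (fun t : ℝ => S |t| x) (𝓝 0) (𝓝 x) := by
  have h1 : Tendsto (fun t : ℝ => S t x) (𝓝[≥] 0) (𝓝 x) := by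
    rw [← Set.Ioi_insert, nhdsWithin_insert, tendsto_sup]
    refine ⟨?_, hS.tendsto_zero x⟩
    have := tendsto_pure_nhds (fun t : ℝ => S t x) 0
    rwa [hS.apply_zero] at this
  refine h1.comp (tendsto_nhdsWithin_iff.2 ⟨?_, Eventually.of_forall fun t => abs_nonneg t⟩)
  simpa using (continuous_abs.tendsto (0 : ℝ))

/-- Otherwise ‖S(tₙ)‖ > n for some tₙ → 0, while S(tₙ)x → x is bounded for each x, against
Banach–Steinhaus. -/
theorem IsC0Semigroup.exists_bound_near_zero [CompleteSpace X] (hS : IsC0Semigroup S) :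
    ∃ δ > 0, ∃ M : ℝ, ∀ t ∈ Set.Icc (0 : ℝ) δ, ‖S t‖ ≤ M := by
  by_contra! h
  have h' : ∀ n : ℕ, ∃ t ∈ Set.Icc (0 : ℝ) (1 / (n + 1)), (n : ℝ) < ‖S t‖ :=
    fun n => h _ (by positivity) _
  choose t ht hn using h'
  have ht0 : Tendsto t atTop (𝓝 0) :=
    squeeze_zero (fun n => (ht n).1) (fun n => (ht n).2) tendsto_one_div_add_atTop_nhds_zero_nat
  have hb : ∀ x, ∃ C, ∀ n, ‖S (t n) x‖ ≤ C := by
    intro x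
    have h1 : Tendsto (fun n => S (t n) x) atTop (𝓝 x) := by
      refine ((hS.tendsto_abs_zero x).comp ht0).congr fun n => ?_
      simp [abs_of_nonneg (ht n).1]
    obtain ⟨C, hC⟩ := (Metric.isBounded_range_of_tendsto _ h1).exists_norm_le
    exact ⟨C, fun n => hC _ ⟨n, rfl⟩⟩
  obtain ⟨C, hC⟩ := banach_steinhaus hb
  obtain ⟨n, hn'⟩ := exists_nat_gt C
  linarith [hC n, hn n]

theorem IsC0Semigroup.exists_bound [CompleteSpace X] (hS : IsC0Semigroup S) (a : ℝ) :
    ∃ C : ℝ, 0 ≤ C ∧ ∀ t ∈ Set.Icc (0 : ℝ) a, ‖S t‖ ≤ C := by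
  obtain ⟨δ, hδ, M, hM⟩ := hS.exists_bound_near_zero
  have hM0 : 0 ≤ M := (norm_nonneg _).trans (hM 0 ⟨le_rfl, hδ.le⟩)
  have key : ∀ k : ℕ, ∀ t ∈ Set.Icc (0 : ℝ) ((k + 1) * δ), ‖S t‖ ≤ M ^ (k + 1) := by
    intro k
    induction k with
    | zero => intro t ht; simpa using hM t (by simpa using ht)
    | succ k ih =>
      intro t ht
      have ht2 := ht.2
      push_cast at ht2
      have e : S t = (S (t / (k + 2))).comp (S ((k + 1) * (t / (k + 2)))) := by
        rw [← hS.map_add]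
        · congr 1; field_simp; ring
        · exact div_nonneg ht.1 (by positivity)
        · exact mul_nonneg (by positivity) (div_nonneg ht.1 (by positivity))
      have hd : t / (k + 2) ≤ δ := by
        rw [div_le_iff₀ (by positivity)]; linarith
      have hd0 : 0 ≤ t / ((k : ℝ) + 2) := div_nonneg ht.1 (by positivity)
      rw [e, pow_succ']
      exact (ContinuousLinearMap.opNorm_comp_le _ _).trans
        (mul_le_mul (hM _ ⟨hd0, hd⟩)
          (ih _ ⟨by positivity, by gcongr⟩) (norm_nonneg _) hM0)
  obtain ⟨k, hk⟩ := exists_nat_gt (a / δ)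
  refine ⟨M ^ (k + 1), by positivity, fun t ht => key k t ⟨ht.1, ht.2.trans ?_⟩⟩
  rw [div_lt_iff₀ hδ] at hk
  linarith

theorem IsC0Semigroup.continuous_abs_apply [CompleteSpace X] (hS : IsC0Semigroup S) (x : X) :
    Continuous fun t : ℝ => S |t| x := by
  suffices h : ContinuousOn (fun t : ℝ => S t x) (Set.Ici 0) from
    h.comp_continuous continuous_abs fun t => abs_nonneg t
  intro t₀ (ht₀ : 0 ≤ t₀)
  obtain ⟨C, hC0, hC⟩ := hS.exists_bound t₀
  -- Factor out S at the smaller of the two times; that time is at most t₀, so C bounds its norm on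
  -- either side.
  have key : ∀ t : ℝ, 0 ≤ t → ‖S t x - S t₀ x‖ ≤ C * ‖S |t - t₀| x - x‖ := by
    intro t ht
    rcases le_total t t₀ with h | h
    · have e : S t₀ x = S t (S |t - t₀| x) := by
        rw [← hS.apply_add ht (abs_nonneg _), abs_sub_comm, abs_of_nonneg (sub_nonneg.2 h)]
        congr 2; ring
      rw [e, ← map_sub, norm_sub_rev (S |t - t₀| x)]
      exact (S t).le_of_opNorm_le (hC t ⟨ht, h⟩) _
    · have e : S t x = S t₀ (S |t - t₀| x) := by
        rw [← hS.apply_add ht₀ (abs_nonneg _), abs_of_nonneg (sub_nonneg.2 h)]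
        congr 2; ring
      rw [e, ← map_sub]
      exact (S t₀).le_of_opNorm_le (hC t₀ ⟨ht₀, le_rfl⟩) _
  have h0 : Tendsto (fun t : ℝ => C * ‖S |t - t₀| x - x‖) (𝓝[Set.Ici 0] t₀) (𝓝 0) := by
    have h1 : Tendsto (fun t : ℝ => t - t₀) (𝓝[Set.Ici 0] t₀) (𝓝 0) := by
      have : Continuous fun t : ℝ => t - t₀ := by fun_prop
      simpa using (this.tendsto t₀).mono_left nhdsWithin_le_nhds
    have h2 := (((hS.tendsto_abs_zero x).comp h1).sub_const x).norm.const_mul C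
    simpa using h2
  refine tendsto_iff_norm_sub_tendsto_zero.2 (squeeze_zero' ?_ ?_ h0)
  · exact Eventually.of_forall fun _ => norm_nonneg _
  · filter_upwards [self_mem_nhdsWithin] with t ht using key t ht

/-- Strong continuity plus locally uniform Lipschitz bounds. It makes τ ↦ S(t-τ)b w(τ) measurable
for merely measurable w. -/
theorem IsC0Semigroup.continuous_uncurry_abs [CompleteSpace X] (hS : IsC0Semigroup S) :
    Continuous fun p : ℝ × X => S |p.1| p.2 := by
  rw [continuous_iff_continuousAt]
  rintro ⟨t₀, x₀⟩
  obtain ⟨C, hC0, hC⟩ := hS.exists_bound (|t₀| + 1)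
  have h := continuousOn_prod_of_continuousOn_lipschitzOnWith'
    (fun p : ℝ × X => S |p.1| p.2) (s := Set.Ioo (t₀ - 1) (t₀ + 1)) (t := Set.univ) C.toNNReal
    (fun t ht => by
      refine LipschitzWith.lipschitzOnWith (LipschitzWith.of_dist_le_mul fun x y => ?_)
      rw [Real.coe_toNNReal _ hC0, dist_eq_norm, dist_eq_norm, ← map_sub]
      refine (S |t|).le_of_opNorm_le (hC _ ⟨abs_nonneg _, ?_⟩) _
      have h1 : |t - t₀| ≤ 1 := abs_le.2 ⟨by linarith [ht.1], by linarith [ht.2]⟩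
      have h2 := abs_add_le (t - t₀) t₀
      rw [sub_add_cancel] at h2
      linarith)
    (fun x _ => (hS.continuous_abs_apply x).continuousOn)
  refine h.continuousAt (prod_mem_nhds (Ioo_mem_nhds ?_ ?_) univ_mem) <;> linarith

theorem exists_integralOp [CompleteSpace X] (hS : IsC0Semigroup S) (h : ℝ) :
    ∃ W : X →L[ℂ] X, ∀ x, W x = ∫ s in (0 : ℝ)..h, S |s| x := by
  obtain ⟨C, hC0, hC⟩ := hS.exists_bound |h|
  let L : X →ₗ[ℂ] X :=
    { toFun := fun x => ∫ s in (0 : ℝ)..h, S |s| x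
      map_add' := fun x y => by
        simp only [map_add]
        exact intervalIntegral.integral_add ((hS.continuous_abs_apply x).intervalIntegrable _ _)
          ((hS.continuous_abs_apply y).intervalIntegrable _ _)
      map_smul' := fun c x => by
        simp only [map_smul]
        exact intervalIntegral.integral_smul c _ }
  refine ⟨L.mkContinuous (C * |h|) fun x => ?_, fun x => rfl⟩
  have h1 := intervalIntegral.norm_integral_le_of_norm_le_const (a := 0) (b := h) (C := C * ‖x‖)
    (f := fun s => S |s| x) (fun s hs => by
      refine (S |s|).le_of_opNorm_le (hC _ ⟨abs_nonneg _, ?_⟩) _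
      have h1 := Set.abs_sub_left_of_mem_uIcc (Set.uIoc_subset_uIcc hs)
      simpa using h1)
  rw [sub_zero] at h1
  change ‖∫ s in (0 : ℝ)..h, S |s| x‖ ≤ _
  linarith

theorem hasDerivWithinAt_semigroup [CompleteSpace X] (hS : IsC0Semigroup S) {A : X →ₗ.[ℂ] X}
    (hA : IsGenerator A S) (y : A.domain) {t : ℝ} (ht : 0 ≤ t) :
    HasDerivWithinAt (fun s : ℝ => S |s| (y : X)) (S t (A y)) (Set.Ici t) t := by
  have h0 : Tendsto (fun h : ℝ => (h : ℂ)⁻¹ • (S h (y : X) - y)) (𝓝[>] 0) (𝓝 (A y)) :=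
    (hA _ _).1 (A.mem_graph y)
  have h1 := ((S t).continuous.tendsto _).comp h0
  rw [← hasDerivWithinAt_Ioi_iff_Ici, hasDerivWithinAt_iff_tendsto_slope' (by simp)]
  have h2 : Tendsto (fun s : ℝ => s - t) (𝓝[>] t) (𝓝[>] 0) := by
    refine tendsto_nhdsWithin_iff.2 ⟨?_, ?_⟩
    · have : Continuous fun s : ℝ => s - t := by fun_prop
      simpa using (this.tendsto t).mono_left nhdsWithin_le_nhds
    · filter_upwards [self_mem_nhdsWithin] with s (hs : t < s) using sub_pos.2 hs
  refine (h1.comp h2).congr' ?_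
  filter_upwards [self_mem_nhdsWithin] with s (hs : t < s)
  have e : S s (y : X) = S t (S (s - t) y) := by
    rw [← hS.apply_add ht (sub_nonneg.2 hs.le), add_sub_cancel]
  simp only [Function.comp_apply, slope_def_module]
  rw [abs_of_nonneg (ht.trans hs.le), abs_of_nonneg ht, e, ← map_sub, map_smul,
    ← Complex.coe_smul, Complex.ofReal_inv]

theorem integral_semigroup_generator [CompleteSpace X] (hS : IsC0Semigroup S) {A : X →ₗ.[ℂ] X}
    (hA : IsGenerator A S) (y : A.domain) {h : ℝ} (hh : 0 ≤ h) :
    ∫ s in (0 : ℝ)..h, S |s| (A y) = S h y - y := by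
  have := intervalIntegral.integral_eq_sub_of_hasDeriv_right_of_le (a := 0) (b := h) hh
    (f := fun s => S |s| (y : X)) (f' := fun s => S |s| (A y))
    (hS.continuous_abs_apply _).continuousOn
    (fun s hs => by
      rw [abs_of_nonneg hs.1.le]
      exact (hasDerivWithinAt_semigroup hS hA y hs.1.le).Ioi_of_Ici)
    ((hS.continuous_abs_apply _).intervalIntegrable _ _)
  rw [this, abs_of_nonneg hh, abs_zero, hS.apply_zero]

end Semigroup

/-! ### Transport of the control system from V into X by the resolvent. -/

section Extrapolation

variable {S : ℝ → X →L[ℂ] X} {R : X →L[ℂ] X}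

/-- The resolvent extends to an isometry `V → X`, which intertwines `𝒮(t)` with `S(t)`. -/
theorem exists_extension_resolvent [CompleteSpace X] (R : X →L[ℂ] X) :
    ∃ J : Extrapolation R →ₗᵢ[ℂ] X, ∀ x, J (toV R x) = R x := by
  let R₀ : PreExtrapolation R →L[ℂ] X :=
    (PreExtrapolation.lin R).mkContinuous 1 fun x => by rw [one_mul]; exact le_rfl
  let e : PreExtrapolation R →L[ℂ] Extrapolation R := UniformSpace.Completion.toComplL
  have he : ∀ x : X, R₀.extend e (toV R x) = R x :=
    fun x => ContinuousLinearMap.extend_eq R₀ (e := e) UniformSpace.Completion.denseRange_coe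
      (UniformSpace.Completion.isUniformInducing_coe (PreExtrapolation R)) x
  refine ⟨⟨(R₀.extend e).toLinearMap, fun v => ?_⟩, he⟩
  change ‖R₀.extend e v‖ = ‖v‖
  refine (denseRange_toV R).induction_on (p := fun v => ‖R₀.extend e v‖ = ‖v‖) v ?_ fun x => ?_
  · exact isClosed_eq (R₀.extend e).continuous.norm continuous_norm
  · rw [he, norm_toV]

theorem extension_resolvent_extendToV {L : X →L[ℂ] X} (h : ∀ x, R (L x) = L (R x))
    {J : Extrapolation R →ₗᵢ[ℂ] X} (hJ : ∀ x, J (toV R x) = R x) (v : Extrapolation R) :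
    J (extendToV R L v) = L (J v) := by
  refine (denseRange_toV R).induction_on
    (p := fun v => J (extendToV R L v) = L (J v)) v ?_ fun x => ?_
  · exact isClosed_eq (J.continuous.comp (extendToV_toV h).1) (L.continuous.comp J.continuous)
  · rw [(extendToV_toV h).2, hJ, hJ, h]

theorem extension_resolvent_inputMap [CompleteSpace X]
    (hc : ∀ t, 0 ≤ t → ∀ x, R (S t x) = S t (R x))
    {J : Extrapolation R →ₗᵢ[ℂ] X} (hJ : ∀ x, J (toV R x) = R x) (B : U →L[ℂ] Extrapolation R)
    {t : ℝ} (ht : 0 ≤ t) (u : Control U t) :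
    J (inputMap R S B t u) = ∫ τ in (0 : ℝ)..t, S |t - τ| (J (B (u τ))) := by
  rw [inputMap, ← J.intervalIntegral_comp_comm]
  refine intervalIntegral.integral_congr fun τ hτ => ?_
  rw [Set.uIcc_of_le ht] at hτ
  have h0 : 0 ≤ t - τ := sub_nonneg.2 hτ.2
  simp only [semigroupV]
  rw [extension_resolvent_extendToV (hc _ h0) hJ, abs_of_nonneg h0]

theorem extension_resolvent_inputMap_toLp [CompleteSpace X]
    (hc : ∀ t, 0 ≤ t → ∀ x, R (S t x) = S t (R x))
    {J : Extrapolation R →ₗᵢ[ℂ] X} (hJ : ∀ x, J (toV R x) = R x) (B : U →L[ℂ] Extrapolation R)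
    {t : ℝ} (ht : 0 ≤ t) {w : ℝ → U} (hw : MemLp w 2 (volume.restrict (Set.Icc 0 t))) :
    J (inputMap R S B t (hw.toLp w)) = ∫ τ in (0 : ℝ)..t, S |t - τ| (J (B (w τ))) := by
  rw [extension_resolvent_inputMap hc hJ B ht, intervalIntegral.integral_of_le ht,
    intervalIntegral.integral_of_le ht]
  refine integral_congr_ae ?_
  have h1 := ae_mono (Measure.restrict_mono Set.Ioc_subset_Icc_self le_rfl) hw.coeFn_toLp
  filter_upwards [h1] with τ hτ
  rw [hτ]

theorem mem_attainableSet_iff [CompleteSpace X] (hc : ∀ t, 0 ≤ t → ∀ x, R (S t x) = S t (R x))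
    {J : Extrapolation R →ₗᵢ[ℂ] X} (hJ : ∀ x, J (toV R x) = R x) (B : U →L[ℂ] Extrapolation R)
    {t : ℝ} (ht : 0 ≤ t) {x : X} :
    x ∈ attainableSet R S B t ↔ ∃ w : ℝ → U, MemLp w 2 (volume.restrict (Set.Icc 0 t)) ∧
      R x = ∫ τ in (0 : ℝ)..t, S |t - τ| (J (B (w τ))) := by
  have e : ∀ u : Control U t, toV R x = weakSolution R S B t 0 u ↔
      R x = J (inputMap R S B t u) := by
    intro u
    rw [weakSolution, map_zero, map_zero, zero_add, ← hJ, J.injective.eq_iff]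
  constructor
  · rintro ⟨u, hu⟩
    exact ⟨u, Lp.memLp u, ((e u).1 hu).trans (extension_resolvent_inputMap hc hJ B ht u)⟩
  · rintro ⟨w, hw, h⟩
    exact ⟨hw.toLp w, (e _).2 (h.trans (extension_resolvent_inputMap_toLp hc hJ B ht hw).symm)⟩

theorem IsAdmissible.exists_resolvent_eq [CompleteSpace X] {B : U →L[ℂ] Extrapolation R}
    (hB : IsAdmissible R S B) (hc : ∀ t, 0 ≤ t → ∀ x, R (S t x) = S t (R x))
    {J : Extrapolation R →ₗᵢ[ℂ] X} (hJ : ∀ x, J (toV R x) = R x)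
    {t : ℝ} (ht : 0 ≤ t) {w : ℝ → U} (hw : MemLp w 2 (volume.restrict (Set.Icc 0 t))) :
    ∃ x, R x = ∫ τ in (0 : ℝ)..t, S |t - τ| (J (B (w τ))) := by
  obtain ⟨Φ, hΦ⟩ := hB t ht
  exact ⟨Φ (hw.toLp w), by
    rw [← hJ, hΦ, extension_resolvent_inputMap_toLp hc hJ B ht hw]⟩

theorem exists_submodule_eq_attainableSet {B : U →L[ℂ] Extrapolation R} (hR : Function.Injective R)
    (hB : IsAdmissible R S B) {t : ℝ} (ht : 0 ≤ t) :
    ∃ K : Submodule ℂ X, (K : Set X) = attainableSet R S B t := by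
  obtain ⟨Φ, hΦ⟩ := hB t ht
  have hinj : Function.Injective (toV R) := by
    refine (injective_iff_map_eq_zero (toV R)).2 fun x hx => ?_
    have : ‖R x‖ = 0 := by rw [← norm_toV, hx, norm_zero]
    exact (injective_iff_map_eq_zero R).1 hR x (norm_eq_zero.1 this)
  refine ⟨LinearMap.range Φ.toLinearMap, ?_⟩
  ext x
  simp only [attainableSet, weakSolution, map_zero, zero_add, Set.mem_ofPred_eq, SetLike.mem_coe,
    LinearMap.mem_range]
  refine exists_congr fun u => ?_
  rw [← hΦ u, hinj.eq_iff, eq_comm]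
  rfl

end Extrapolation

/-! ### Delaying and prolonging controls. -/

section Attainable

variable {S : ℝ → X →L[ℂ] X}

theorem intervalIntegrable_convolution [CompleteSpace X] (hS : IsC0Semigroup S) (b : U →L[ℂ] X) {t : ℝ}
    (ht : 0 ≤ t) {w : ℝ → U} (hw : MemLp w 2 (volume.restrict (Set.Icc 0 t))) :
    IntervalIntegrable (fun τ => S |t - τ| (b (w τ))) volume 0 t := by
  rw [intervalIntegrable_iff_integrableOn_Icc_of_le ht]
  have hwi : Integrable w (volume.restrict (Set.Icc 0 t)) := hw.integrable one_le_two
  obtain ⟨C, hC0, hC⟩ := hS.exists_bound t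
  have hbi : Integrable (fun τ => b (w τ)) (volume.restrict (Set.Icc 0 t)) :=
    b.integrable_comp hwi
  refine Integrable.mono' (hbi.norm.const_mul C) ?_ ?_
  · have hm : AEStronglyMeasurable (fun τ : ℝ => (t - τ, b (w τ)))
        (volume.restrict (Set.Icc 0 t)) :=
      AEStronglyMeasurable.prodMk (by fun_prop) hbi.1
    exact hS.continuous_uncurry_abs.comp_aestronglyMeasurable hm
  · filter_upwards [ae_restrict_mem measurableSet_Icc] with τ hτ
    refine (S _).le_of_opNorm_le (hC _ ⟨abs_nonneg _, ?_⟩) _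
    rw [abs_of_nonneg (sub_nonneg.2 hτ.2)]
    linarith [hτ.1]

/-- Wait for time d with zero control, then apply w: the system stays at the origin meanwhile. -/
theorem exists_delayed_control (b : U →L[ℂ] X) {t d : ℝ} (ht : 0 ≤ t)
    (hd : 0 ≤ d) {w : ℝ → U} (hw : MemLp w 2 (volume.restrict (Set.Icc 0 t))) :
    ∃ w' : ℝ → U, MemLp w' 2 (volume.restrict (Set.Icc 0 (t + d))) ∧
      ∫ τ in (0 : ℝ)..(t + d), S |t + d - τ| (b (w' τ)) =
        ∫ τ in (0 : ℝ)..t, S |t - τ| (b (w τ)) := by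
  refine ⟨(Set.Ioc d (t + d)).indicator fun τ => w (τ - d), ?_, ?_⟩
  · refine MemLp.mono_measure Measure.restrict_le_self
      ((memLp_indicator_iff_restrict measurableSet_Ioc).2 ?_)
    have hp := (measurePreserving_sub_right (volume : Measure ℝ) d).restrict_preimage
      (measurableSet_Icc (a := (0 : ℝ)) (b := t))
    have h1 := hw.comp_measurePreserving hp
    refine h1.mono_measure (Measure.restrict_mono ?_ le_rfl)
    intro τ hτ
    exact ⟨by linarith [hτ.1], by linarith [hτ.2]⟩
  · have e : ∀ τ, S |t + d - τ| (b ((Set.Ioc d (t + d)).indicator (fun τ => w (τ - d)) τ)) =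
        (Set.Ioc d (t + d)).indicator (fun τ => S |t - (τ - d)| (b (w (τ - d)))) τ := by
      intro τ
      by_cases h : τ ∈ Set.Ioc d (t + d)
      · rw [Set.indicator_of_mem h, Set.indicator_of_mem h, show t + d - τ = t - (τ - d) by ring]
      · rw [Set.indicator_of_notMem h, Set.indicator_of_notMem h, map_zero, map_zero]
    simp only [e]
    rw [intervalIntegral.integral_of_le (by linarith), setIntegral_indicator measurableSet_Ioc,
      Set.inter_eq_self_of_subset_right (Set.Ioc_subset_Ioc_left hd),
      ← intervalIntegral.integral_of_le (by linarith),
      intervalIntegral.integral_comp_sub_right (fun τ => S |t - τ| (b (w τ))) d]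
    simp

/-- Apply w up to time t, then zero control: the state reached evolves freely for time s. -/
theorem exists_prolonged_control [CompleteSpace X] (hS : IsC0Semigroup S) (b : U →L[ℂ] X)
    {t s : ℝ} (ht : 0 ≤ t) (hs : 0 ≤ s) {w : ℝ → U}
    (hw : MemLp w 2 (volume.restrict (Set.Icc 0 t))) :
    ∃ w' : ℝ → U, MemLp w' 2 (volume.restrict (Set.Icc 0 (t + s))) ∧
      ∫ τ in (0 : ℝ)..(t + s), S |t + s - τ| (b (w' τ)) =
        S s (∫ τ in (0 : ℝ)..t, S |t - τ| (b (w τ))) := by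
  refine ⟨(Set.Icc 0 t).indicator w, ?_, ?_⟩
  · exact MemLp.mono_measure Measure.restrict_le_self
      ((memLp_indicator_iff_restrict measurableSet_Icc).2 hw)
  · have e : ∀ τ, S |t + s - τ| (b ((Set.Icc 0 t).indicator w τ)) =
        (Set.Icc 0 t).indicator (fun τ => S s (S |t - τ| (b (w τ)))) τ := by
      intro τ
      by_cases h : τ ∈ Set.Icc 0 t
      · rw [Set.indicator_of_mem h, Set.indicator_of_mem h, ← hS.apply_add hs (abs_nonneg _)]
        rw [abs_of_nonneg (sub_nonneg.2 h.2), abs_of_nonneg (by linarith [h.2]),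
          show t + s - τ = s + (t - τ) by ring]
      · rw [Set.indicator_of_notMem h, Set.indicator_of_notMem h, map_zero, map_zero]
    simp only [e]
    rw [intervalIntegral.integral_of_le (by linarith), ← integral_Icc_eq_integral_Ioc,
      setIntegral_indicator measurableSet_Icc,
      Set.inter_eq_self_of_subset_right (Set.Icc_subset_Icc_right (by linarith)),
      integral_Icc_eq_integral_Ioc, ← intervalIntegral.integral_of_le ht]
    exact (S s).intervalIntegral_comp_comm (intervalIntegrable_convolution hS b ht hw)

end Attainable

/-! ### Exponential polynomials on generalized eigenspaces, and minimality. -/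

section Eigenspaces

open Polynomial

variable {S : ℝ → X →L[ℂ] X} {A : X →ₗ.[ℂ] X} {l : ℂ}

theorem mem_kerPow_succ {n : ℕ} {x : X} :
    x ∈ kerPow A l (n + 1) ↔
      ∃ y : A.domain, A y - l • (y : X) ∈ kerPow A l n ∧ (y : X) = x := by
  simp only [kerPow, Submodule.mem_map, Submodule.mem_comap]
  rfl

theorem kerPow_mono : Monotone (kerPow A l) := by
  refine monotone_nat_of_le_succ fun n => ?_
  induction n with
  | zero => exact bot_le
  | succ n ih => exact Submodule.map_mono (Submodule.comap_mono ih)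

theorem kerPow_eq_of_eq_succ {n m : ℕ} (h : kerPow A l n = kerPow A l (n + 1)) (hm : n ≤ m) :
    kerPow A l m = kerPow A l n := by
  induction m, hm using Nat.le_induction with
  | base => rfl
  | succ m _ ih =>
    rw [h]
    change ((kerPow A l m).comap _).map _ = ((kerPow A l n).comap _).map _
    rw [ih]

/-- The dimension grows at each step until the chain stabilizes for good, so the chain is exhausted
after at most `multiplicity A l` steps. -/
theorem kerPow_multiplicity [FiniteDimensional ℂ (genEigenspace A l)] :
    kerPow A l (multiplicity A l) = genEigenspace A l := by
  have hle : ∀ n, kerPow A l n ≤ genEigenspace A l := fun n => le_iSup (kerPow A l) n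
  have hfin : ∀ n, FiniteDimensional ℂ (kerPow A l n) :=
    fun n => Submodule.finiteDimensional_of_le (hle n)
  have key : ∀ n, n ≤ Module.finrank ℂ (kerPow A l n) ∨
      ∃ k < n, kerPow A l k = kerPow A l (k + 1) := by
    intro n
    induction n with
    | zero => exact Or.inl (Nat.zero_le _)
    | succ n ih =>
      rcases ih with h | ⟨k, hk, h⟩
      · by_cases he : kerPow A l n = kerPow A l (n + 1)
        · exact Or.inr ⟨n, n.lt_succ_self, he⟩
        · have hlt := Submodule.finrank_lt_finrank_of_lt
            (lt_of_le_of_ne (kerPow_mono (A := A) (l := l) n.le_succ) he)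
          exact Or.inl (h.trans_lt hlt)
      · exact Or.inr ⟨k, hk.trans n.lt_succ_self, h⟩
  rcases key (multiplicity A l) with h | ⟨k, hk, h⟩
  · exact Submodule.eq_of_le_of_finrank_le (hle _) h
  · refine le_antisymm (hle _) (iSup_le fun n => ?_)
    rw [kerPow_eq_of_eq_succ h hk.le]
    rcases le_total k n with h' | h'
    · rw [kerPow_eq_of_eq_succ h h']
    · exact kerPow_mono h'

/-- The right derivative of e^{-ls}S(s)y is e^{-ls}S(s)(A-l)y, a polynomial of lower degree by
induction; integrate it. -/
theorem exists_semigroup_apply_kerPow [CompleteSpace X] (hS : IsC0Semigroup S)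
    (hA : IsGenerator A S) (n : ℕ) {y : X} (hy : y ∈ kerPow A l n) :
    ∃ c : ℕ → X, ∀ s : ℝ, 0 ≤ s →
      S s y = Complex.exp (l * s) • ∑ k ∈ Finset.range n, (s : ℂ) ^ k • c k := by
  induction n generalizing y with
  | zero =>
    rw [show y = 0 from (Submodule.mem_bot ℂ).1 hy]
    exact ⟨0, fun s _ => by simp⟩
  | succ n ih =>
    obtain ⟨y, hz, rfl⟩ := mem_kerPow_succ.1 hy
    obtain ⟨c, hc⟩ := ih hz
    -- Coefficients of the antiderivative with constant term y.
    refine ⟨fun k => Nat.casesOn k (y : X) fun k => ((k : ℂ) + 1)⁻¹ • c k, fun s hs => ?_⟩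
    let g : ℝ → X := fun s => Complex.exp (-l * s) • S |s| (y : X) -
      ∑ k ∈ Finset.range n, (s : ℂ) ^ (k + 1) • ((k : ℂ) + 1)⁻¹ • c k
    have hd1 : ∀ r : ℝ, HasDerivAt (fun s : ℝ => Complex.exp (-l * s))
        (Complex.exp (-l * r) * (-l)) r := fun r => by
      have := ((hasDerivAt_id (r : ℂ)).const_mul (-l)).cexp.comp_ofReal
      simpa using this
    have hd2 : ∀ r : ℝ, HasDerivAt
        (fun s : ℝ => ∑ k ∈ Finset.range n, (s : ℂ) ^ (k + 1) • ((k : ℂ) + 1)⁻¹ • c k)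
        (∑ k ∈ Finset.range n, (r : ℂ) ^ k • c k) r := fun r => by
      refine HasDerivAt.fun_sum fun k _ => ?_
      have h1 := ((hasDerivAt_pow (k + 1) (r : ℂ)).comp_ofReal).smul_const
        (((k : ℂ) + 1)⁻¹ • c k)
      refine h1.congr_deriv ?_
      have hk : (k : ℂ) + 1 ≠ 0 := Nat.cast_add_one_ne_zero k
      rw [smul_smul]
      congr 1
      push_cast
      field_simp
    have hderiv : ∀ r ∈ Set.Ico 0 s, HasDerivWithinAt g 0 (Set.Ici r) r := by
      intro r hr
      have h1 := ((hd1 r).hasDerivWithinAt (s := Set.Ici r)).smul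
        (hasDerivWithinAt_semigroup hS hA y hr.1)
      refine (h1.sub (hd2 r).hasDerivWithinAt).congr_deriv ?_
      have h2 := hc r hr.1
      rw [map_sub, map_smul] at h2
      -- The required derivative 0 is written as the sum minus itself, to match the two parts of
      -- `g`.
      rw [abs_of_nonneg hr.1, ← sub_eq_zero.2 (rfl : ∑ k ∈ Finset.range n, (r : ℂ) ^ k • c k = _)]
      congr 1
      rw [mul_smul, ← smul_add, neg_smul, ← sub_eq_add_neg, h2, smul_smul, ← Complex.exp_add]
      simp
    have hcont : ContinuousOn g (Set.Icc 0 s) := by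
      refine ((Continuous.smul ?_ (hS.continuous_abs_apply _)).sub ?_).continuousOn <;> fun_prop
    have h0 := constant_of_has_deriv_right_zero hcont hderiv s ⟨hs, le_rfl⟩
    simp only [g, abs_zero, hS.apply_zero, abs_of_nonneg hs] at h0
    simp only [Complex.ofReal_zero, mul_zero, Complex.exp_zero, one_smul, ne_eq,
      Nat.succ_ne_zero, not_false_eq_true, zero_pow, zero_smul, Finset.sum_const_zero,
      sub_zero] at h0
    rw [sub_eq_iff_eq_add] at h0
    rw [Finset.sum_range_succ', pow_zero, one_smul, add_comm]
    change _ = _ • ((y : X) + ∑ k ∈ Finset.range n, (s : ℂ) ^ (k + 1) • ((k : ℂ) + 1)⁻¹ • c k)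
    rw [← h0, smul_smul, ← Complex.exp_add]
    simp

theorem exists_polynomial_semigroup_apply [CompleteSpace X] (hS : IsC0Semigroup S)
    (hA : IsGenerator A S) [FiniteDimensional ℂ (genEigenspace A l)] {y : X}
    (hy : y ∈ genEigenspace A l) (g : X →L[ℂ] ℂ) :
    ∃ P ∈ degreeLT ℂ (multiplicity A l), ∀ s : ℝ, 0 ≤ s →
      g (S s y) = Complex.exp (l * s) * P.eval (s : ℂ) := by
  rw [← kerPow_multiplicity] at hy
  obtain ⟨c, hc⟩ := exists_semigroup_apply_kerPow hS hA _ hy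
  refine ⟨∑ k ∈ Finset.range (multiplicity A l), monomial k (g (c k)), ?_, fun s hs => ?_⟩
  · refine Submodule.sum_mem _ fun k hk => mem_degreeLT.2 ((degree_monomial_le _ _).trans_lt ?_)
    exact_mod_cast Finset.mem_range.1 hk
  · rw [hc s hs, map_smul, map_sum, smul_eq_mul, eval_finsetSum]
    congr 1
    refine Finset.sum_congr rfl fun k _ => ?_
    rw [map_smul, smul_eq_mul, eval_monomial, mul_comm]

/-- The substitution s = ν - r turns the terms into combinations of `expFamily`. Pairing with a
biorthogonal function isolates one coefficient, the same for all large n, while uniform convergence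
makes the pairing tend to 0. -/
theorem eq_zero_of_tendstoUniformlyOn_expFamily {ν : ℝ} (hν : 0 ≤ ν)
    (hmin : IsMinimalOn (expFamily A) ν) {P : spectrumOf A → ℂ[X]}
    (hP : ∀ l : spectrumOf A, P l ∈ degreeLT ℂ (multiplicity A (l : ℂ)))
    {F : ℕ → Finset (spectrumOf A)}
    (hF : Monotone F) (hcov : ∀ l, ∃ n, l ∈ F n)
    (hlim : TendstoUniformlyOn
      (fun n (s : ℝ) => ∑ l ∈ F n, Complex.exp (l * s) * (P l).eval (s : ℂ)) 0 atTop
      (Set.Icc 0 ν)) (l : spectrumOf A) : P l = 0 := by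
  obtain ⟨y, hy, hy1, hy0⟩ := hmin
  -- Re-expansion about ν: P(ν - r) = Q(-r), which produces the powers (-r)^k.
  let Q : spectrumOf A → ℂ[X] := fun l => taylor (ν : ℂ) (P l)
  have hQ : ∀ l : spectrumOf A, Q l ∈ degreeLT ℂ (multiplicity A (l : ℂ)) := fun l => by
    rw [mem_degreeLT, degree_taylor]; exact mem_degreeLT.1 (hP l)
  have hexpand : ∀ (l : spectrumOf A) (r : ℝ),
      Complex.exp (l * ((ν - r : ℝ) : ℂ)) * (P l).eval ((ν - r : ℝ) : ℂ) =
        ∑ k : Fin (multiplicity A (l : ℂ)),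
          Complex.exp (l * ν) * (Q l).coeff k * expFamily A ⟨l, k⟩ r := by
    intro l r
    have h1 : (P l).eval ((ν - r : ℝ) : ℂ) = (Q l).eval (-(r : ℂ)) := by
      rw [taylor_eval]; congr 1; push_cast; ring
    rw [h1, eval_eq_sum_degreeLTEquiv (hQ l), Finset.mul_sum]
    refine Finset.sum_congr rfl fun k _ => ?_
    have h2 : Complex.exp (l * ((ν - r : ℝ) : ℂ)) =
        Complex.exp (l * ν) * Complex.exp (-l * r) := by
      rw [← Complex.exp_add]; congr 1; push_cast; ring
    rw [h2]
    change _ * _ * ((Q l).coeff k * _) = _ * _ * (_ * _)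
    ring
  have hyi : ∀ j, IntervalIntegrable (y j) volume 0 ν := fun j =>
    (intervalIntegrable_iff_integrableOn_Icc_of_le hν).2 ((hy j).integrable one_le_two)
  have hcontE : ∀ i, Continuous (expFamily A i) := fun i => by
    unfold expFamily; fun_prop
  have hcoeff : ∀ k : Fin (multiplicity A (l : ℂ)), (Q l).coeff k = 0 := by
    intro k
    let j : Σ l : spectrumOf A, Fin (multiplicity A (l : ℂ)) := ⟨l, k⟩
    have hint : ∀ n, l ∈ F n →
        ∫ r in (0 : ℝ)..ν, (∑ l ∈ F n, Complex.exp (l * ((ν - r : ℝ) : ℂ)) *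
          (P l).eval ((ν - r : ℝ) : ℂ)) * y j r = Complex.exp (l * ν) * (Q l).coeff k := by
      intro n hn
      have hii : ∀ i, IntervalIntegrable (fun r => expFamily A i r * y j r) volume 0 ν :=
        fun i => (hyi j).continuousOn_mul (hcontE i).continuousOn
      simp only [hexpand, Finset.sum_mul, Finset.sum_sigma', mul_assoc]
      rw [intervalIntegral.integral_finsetSum fun i _ => ((hii i).const_mul _).const_mul _]
      simp only [intervalIntegral.integral_const_mul]
      rw [Finset.sum_eq_single j]
      · rw [hy1 j, mul_one]
      · intro i _ hi
        rw [hy0 i j hi, mul_zero, mul_zero]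
      · intro h
        exact absurd (Finset.mem_sigma.2 ⟨hn, Finset.mem_univ k⟩) h
    have hbound : ∀ ε > 0, ‖Complex.exp (l * ν) * (Q l).coeff k‖ ≤
        ε * ∫ r in (0 : ℝ)..ν, ‖y j r‖ := by
      intro ε hε
      obtain ⟨n₀, hn₀⟩ := hcov l
      obtain ⟨n, hn, hn'⟩ := ((Metric.tendstoUniformlyOn_iff.1 hlim ε hε).and
        (eventually_ge_atTop n₀)).exists
      rw [← hint n (hF hn' hn₀), ← intervalIntegral.integral_const_mul]
      refine intervalIntegral.norm_integral_le_of_norm_le hν ?_ ((hyi j).norm.const_mul ε)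
      refine Eventually.of_forall fun r hr => ?_
      rw [norm_mul]
      refine mul_le_mul_of_nonneg_right ?_ (norm_nonneg _)
      have := hn (ν - r) ⟨by linarith [hr.2], by linarith [hr.1]⟩
      rw [Pi.zero_apply, dist_zero_left] at this
      exact this.le
    have hzero : ‖Complex.exp (l * ν) * (Q l).coeff k‖ ≤ 0 := by
      have ht : Tendsto (fun ε : ℝ => ε * ∫ r in (0 : ℝ)..ν, ‖y j r‖) (𝓝[>] 0) (𝓝 0) := by
        have h1 : Continuous fun ε : ℝ => ε * ∫ r in (0 : ℝ)..ν, ‖y j r‖ := by fun_prop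
        simpa using (h1.tendsto 0).mono_left nhdsWithin_le_nhds
      refine ge_of_tendsto ht ?_
      filter_upwards [self_mem_nhdsWithin] with ε hε using hbound ε hε
    exact (mul_eq_zero.1 (norm_le_zero_iff.1 hzero)).resolve_left (Complex.exp_ne_zero _)
  refine (taylor_eq_zero (ν : ℂ) (P l)).1 ?_
  ext k
  by_cases hk : k < multiplicity A (l : ℂ)
  · exact hcoeff ⟨k, hk⟩
  · exact coeff_eq_zero_of_degree_lt
      ((mem_degreeLT.1 (hQ l)).trans_le (Nat.cast_le.2 (not_lt.1 hk)))

end Eigenspaces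

/-! ### Functionals annihilating attainable sets, and equality of closures. -/

theorem exists_functional_of_notMem_closure (K : Submodule ℂ X) {x : X}
    (hx : x ∉ closure (K : Set X)) : ∃ f : X →L[ℂ] ℂ, (∀ y ∈ K, f y = 0) ∧ f x ≠ 0 := by
  have hcl : IsClosed (K.topologicalClosure : Set X) := K.isClosed_topologicalClosure
  have hne : K.topologicalClosure.mkQ x ≠ 0 := by
    rw [Submodule.mkQ_apply, Ne, Submodule.Quotient.mk_eq_zero]
    exact hx
  obtain ⟨f, hf⟩ := SeparatingDual.exists_ne_zero (R := ℂ) hne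
  refine ⟨f.comp K.topologicalClosure.mkQL, fun y hy => ?_, hf⟩
  have : K.topologicalClosure.mkQ y = 0 :=
    (Submodule.Quotient.mk_eq_zero _).2 (K.le_topologicalClosure hy)
  change f (K.topologicalClosure.mkQ y) = 0
  rw [this, map_zero]

section AttainableClosure

variable [CompleteSpace X] {S : ℝ → X →L[ℂ] X} {R : X →L[ℂ] X} {A : X →ₗ.[ℂ] X}

/-- If the orbit of `x` expands in generalized eigenvectors at the time `0`, a functional that
vanishes on the orbit during the time `ν` vanishes on it forever. -/
theorem functional_orbit_eq_zero (hS : IsC0Semigroup S) (hA : IsGenerator A S)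
    (hc : ∀ t, 0 ≤ t → ∀ x, R (S t x) = S t (R x))
    (hfin : ∀ l ∈ spectrumOf A, FiniteDimensional ℂ (genEigenspace A l)) {ν : ℝ} (hν : 0 ≤ ν)
    (hmin : IsMinimalOn (expFamily A) ν) {x : X} {y : spectrumOf A → X}
    (hy : ∀ l : spectrumOf A, y l ∈ genEigenspace A (l : ℂ)) {F : ℕ → Finset (spectrumOf A)}
    (hF : Monotone F) (hcov : ∀ l, ∃ n, l ∈ F n)
    (hlim : Tendsto (fun n => ∑ l ∈ F n, R (y l)) atTop (𝓝 x)) {g : X →L[ℂ] ℂ}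
    (hg : ∀ s ∈ Set.Icc 0 ν, g (S s x) = 0) {s : ℝ} (hs : 0 ≤ s) : g (S s x) = 0 := by
  have hP : ∀ l : spectrumOf A, ∃ P ∈ Polynomial.degreeLT ℂ (multiplicity A (l : ℂ)),
      ∀ s : ℝ, 0 ≤ s → (g.comp R) (S s (y l)) = Complex.exp (l * s) * P.eval (s : ℂ) := fun l =>
    have := hfin l l.2
    exists_polynomial_semigroup_apply hS hA (hy l) (g.comp R)
  choose P hPdeg hPeval using hP
  have hsum : ∀ n (s : ℝ), 0 ≤ s → ∑ l ∈ F n, Complex.exp (l * s) * (P l).eval (s : ℂ) =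
      g (S s (∑ l ∈ F n, R (y l))) := by
    intro n s hs
    rw [map_sum, map_sum]
    refine Finset.sum_congr rfl fun l _ => ?_
    rw [← hPeval l s hs, ContinuousLinearMap.comp_apply, hc s hs]
  obtain ⟨C, hC0, hC⟩ := hS.exists_bound ν
  have hunif : TendstoUniformlyOn
      (fun n (s : ℝ) => ∑ l ∈ F n, Complex.exp (l * s) * (P l).eval (s : ℂ)) 0 atTop
      (Set.Icc 0 ν) := by
    rw [Metric.tendstoUniformlyOn_iff]
    intro ε hε
    have h1 : Tendsto (fun n => ‖g‖ * (C * ‖∑ l ∈ F n, R (y l) - x‖)) atTop (𝓝 0) := by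
      simpa using (((hlim.sub_const x).norm).const_mul C).const_mul ‖g‖
    filter_upwards [h1.eventually_lt_const hε] with n hn r hr
    rw [Pi.zero_apply, dist_zero_left, hsum n r hr.1, ← sub_zero (g _), ← hg r hr, ← map_sub,
      ← map_sub]
    refine lt_of_le_of_lt (g.le_opNorm_of_le ?_) hn
    exact (S r).le_of_opNorm_le (hC r hr) _
  have hPzero := eq_zero_of_tendstoUniformlyOn_expFamily hν hmin hPdeg hF hcov hunif
  have h2 : Tendsto (fun n => g (S s (∑ l ∈ F n, R (y l)))) atTop (𝓝 (g (S s x))) :=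
    ((g.continuous.comp (S s).continuous).tendsto x).comp hlim
  refine tendsto_nhds_unique h2 (tendsto_const_nhds.congr fun n => ?_)
  rw [← hsum n s hs]
  simp [hPzero]

/-- With φ(τ) = g(S(t-τ)bβ), the control conj(φ)β turns the hypothesis into ∫|φ|² = 0, and φ is
continuous. -/
theorem functional_eq_zero_of_convolution_eq_zero (hS : IsC0Semigroup S) (b : U →L[ℂ] X) {t : ℝ}
    (ht : 0 < t) {g : X →L[ℂ] ℂ}
    (hg : ∀ w : ℝ → U, MemLp w 2 (volume.restrict (Set.Icc 0 t)) →
      g (∫ τ in (0 : ℝ)..t, S |t - τ| (b (w τ))) = 0) (β : U) {s : ℝ} (hs : s ∈ Set.Icc 0 t) :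
    g (S s (b β)) = 0 := by
  let φ : ℝ → ℂ := fun τ => g (S |t - τ| (b β))
  have hφ : Continuous φ :=
    g.continuous.comp ((hS.continuous_abs_apply (b β)).comp (continuous_const.sub continuous_id))
  let w : ℝ → U := fun τ => (starRingEnd ℂ) (φ τ) • β
  have hw : Continuous w := (Complex.continuous_conj.comp hφ).smul continuous_const
  have hwL : MemLp w 2 (volume.restrict (Set.Icc 0 t)) := by
    obtain ⟨C, hC⟩ := (isCompact_Icc (a := (0 : ℝ)) (b := t)).exists_bound_of_continuousOn
      hw.continuousOn
    refine MemLp.of_bound hw.aestronglyMeasurable C ?_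
    filter_upwards [ae_restrict_mem measurableSet_Icc] with τ hτ using hC τ hτ
  have h1 := hg w hwL
  rw [← g.intervalIntegral_comp_comm (intervalIntegrable_convolution hS b ht.le hwL)] at h1
  have h2 : ∀ τ, g (S |t - τ| (b (w τ))) = ((‖φ τ‖ ^ 2 : ℝ) : ℂ) := by
    intro τ
    simp only [w, map_smul, smul_eq_mul]
    rw [mul_comm]
    simpa using Complex.mul_conj' (φ τ)
  simp only [h2] at h1
  rw [intervalIntegral.integral_ofReal, Complex.ofReal_eq_zero] at h1
  have hcont : Continuous fun τ => ‖φ τ‖ ^ 2 := hφ.norm.pow 2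
  have hτ : t - s ∈ Set.Icc 0 t := ⟨by linarith [hs.2], by linarith [hs.1]⟩
  have h3 : φ (t - s) = 0 := by
    by_contra hne
    have := intervalIntegral.integral_pos ht hcont.continuousOn (fun _ _ => by positivity)
      ⟨t - s, hτ, by positivity⟩
    exact this.ne' h1
  simpa [φ, abs_of_nonneg hs.1] using h3

theorem attainableSet_mono {μ : ℂ} (hS : IsC0Semigroup S) (hA : IsGenerator A S)
    (hR : IsResolventAt A μ R) (B : U →L[ℂ] Extrapolation R) {t₁ t₂ : ℝ} (h0 : 0 ≤ t₁)
    (h : t₁ ≤ t₂) : attainableSet R S B t₁ ⊆ attainableSet R S B t₂ := by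
  have hc : ∀ t, 0 ≤ t → ∀ x, R (S t x) = S t (R x) := fun t ht x => resolvent_comm hS hA hR ht x
  obtain ⟨J, hJ⟩ := exists_extension_resolvent R
  intro x hx
  obtain ⟨w, hw, hx⟩ := (mem_attainableSet_iff hc hJ B h0).1 hx
  obtain ⟨w', hw', e⟩ := exists_delayed_control (S := S) (J.toContinuousLinearMap.comp B) h0
    (sub_nonneg.2 h) hw
  rw [add_sub_cancel] at hw' e
  exact (mem_attainableSet_iff hc hJ B (h0.trans h)).2 ⟨w', hw', hx.trans e.symm⟩

theorem semigroup_apply_mem_attainableSet {μ : ℂ} (hS : IsC0Semigroup S) (hA : IsGenerator A S)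
    (hR : IsResolventAt A μ R) (B : U →L[ℂ] Extrapolation R) {t s : ℝ} (ht : 0 ≤ t)
    (hs : 0 ≤ s) {x : X} (hx : x ∈ attainableSet R S B t) :
    S s x ∈ attainableSet R S B (t + s) := by
  have hc : ∀ t, 0 ≤ t → ∀ x, R (S t x) = S t (R x) := fun t ht x => resolvent_comm hS hA hR ht x
  obtain ⟨J, hJ⟩ := exists_extension_resolvent R
  obtain ⟨w, hw, hx⟩ := (mem_attainableSet_iff hc hJ B ht).1 hx
  obtain ⟨w', hw', e⟩ := exists_prolonged_control hS (J.toContinuousLinearMap.comp B) ht hs hw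
  refine (mem_attainableSet_iff hc hJ B (add_nonneg ht hs)).2 ⟨w', hw', ?_⟩
  rw [hc s hs, hx]
  exact e.symm

/-- The averages `x ↦ ∫₀ʰ f (S(s) x) ds` of a functional `f ∈ X*` are continuous in the norm of
`V`; they take the place of an approximation of `f` by elements of `D(A*)`. -/
theorem exists_mollified_functional {μ : ℂ} (hS : IsC0Semigroup S) (hA : IsGenerator A S)
    (hR : IsResolventAt A μ R) (f : X →L[ℂ] ℂ) {h : ℝ} (hh : 0 ≤ h) :
    ∃ g : X →L[ℂ] ℂ, ∀ x, g (R x) = ∫ s in (0 : ℝ)..h, f (S |s| x) := by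
  obtain ⟨W, hW⟩ := exists_integralOp hS h
  -- From x = μRx - ARx and ∫₀ʰ S(s)A(Rx)ds = S(h)Rx - Rx.
  refine ⟨f.comp (μ • W - (S h - ContinuousLinearMap.id ℂ X)), fun x => ?_⟩
  rw [f.intervalIntegral_comp_comm ((hS.continuous_abs_apply x).intervalIntegrable _ _), ← hW]
  obtain ⟨hx, hx'⟩ := hR.1 x
  have h1 := integral_semigroup_generator hS hA ⟨R x, hx⟩ hh
  rw [← hW] at h1
  conv_rhs => rw [← hx', map_sub, map_smul, h1]
  rfl

theorem eq_zero_of_integral_eq_zero {ψ : ℝ → ℂ} (hψ : Continuous ψ) {δ : ℝ} (hδ : 0 < δ)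
    (h : ∀ r ∈ Set.Ico 0 δ, ∫ s in (0 : ℝ)..r, ψ s = 0) : ψ 0 = 0 := by
  have h1 : HasDerivWithinAt (fun r => ∫ s in (0 : ℝ)..r, ψ s) (ψ 0) (Set.Ici 0) 0 :=
    (hψ.integral_hasStrictDerivAt 0 0).hasDerivAt.hasDerivWithinAt
  have h2 : HasDerivWithinAt (fun r => ∫ s in (0 : ℝ)..r, ψ s) 0 (Set.Ici 0) 0 := by
    refine (hasDerivWithinAt_const (0 : ℝ) (Set.Ici (0 : ℝ)) (0 : ℂ)).congr_of_eventuallyEq ?_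
      (by simp)
    filter_upwards [Ico_mem_nhdsGE hδ] with r hr using h r hr
  exact (uniqueDiffWithinAt_Ici (0 : ℝ)).eq_deriv _ h1 h2

theorem attainableSet_subset_closure {μ : ℂ} (hS : IsC0Semigroup S) (hA : IsGenerator A S)
    (hR : IsResolventAt A μ R) {B : U →L[ℂ] Extrapolation R} (hB : IsAdmissible R S B)
    {T ν : ℝ} (hT : 0 ≤ T) (hν : 0 < ν)
    (hfin : ∀ l ∈ spectrumOf A, FiniteDimensional ℂ (genEigenspace A l))
    (hIII : PropertyIII A R S T) (hmin : IsMinimalOn (expFamily A) ν) {t₁ t₂ : ℝ}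
    (h₁ : T + ν < t₁) (h₂ : 0 ≤ t₂) :
    attainableSet R S B t₂ ⊆ closure (attainableSet R S B t₁) := by
  have hc : ∀ t, 0 ≤ t → ∀ x, R (S t x) = S t (R x) := fun t ht x => resolvent_comm hS hA hR ht x
  obtain ⟨J, hJ⟩ := exists_extension_resolvent R
  have hinj : Function.Injective R := by
    refine (injective_iff_map_eq_zero R).2 fun x hx => ?_
    obtain ⟨h, h'⟩ := hR.1 x
    have h0 : (⟨R x, h⟩ : A.domain) = 0 := Subtype.ext hx
    rw [h0, LinearPMap.map_zero, hx, smul_zero, sub_zero] at h'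
    exact h'.symm
  let b : U →L[ℂ] X := J.toContinuousLinearMap.comp B
  obtain ⟨K, hK⟩ := exists_submodule_eq_attainableSet hinj hB (t := t₁) (by linarith)
  rw [← hK]
  intro x hx
  by_contra hxK
  obtain ⟨f, hf, hfx⟩ := exists_functional_of_notMem_closure K hxK
  refine hfx ?_
  have hψ : Continuous fun s : ℝ => f (S |s| x) := f.continuous.comp (hS.continuous_abs_apply x)
  -- Averaging over [0,r] costs time r; this range of r is what keeps t₁ - r above T + ν.
  suffices h : ∀ r ∈ Set.Ico 0 (t₁ - (T + ν)), ∫ s in (0 : ℝ)..r, f (S |s| x) = 0 by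
    have := eq_zero_of_integral_eq_zero hψ (sub_pos.2 h₁) h
    rwa [abs_zero, hS.apply_zero] at this
  intro r hr
  obtain ⟨g, hg⟩ := exists_mollified_functional hS hA hR f hr.1
  set t := t₁ - r with ht_def
  have ht : T + ν < t := by linarith [hr.2]
  have ht0 : 0 < t := by linarith
  have hgK : ∀ z ∈ attainableSet R S B t, g (R z) = 0 := by
    intro z hz
    rw [hg]
    refine (intervalIntegral.integral_congr (g := fun _ => 0) fun s hs => ?_).trans (by simp)
    rw [Set.uIcc_of_le hr.1] at hs
    have hmem := attainableSet_mono hS hA hR B (by linarith [hs.1])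
      (by linarith [hs.2] : t + s ≤ t₁)
      (semigroup_apply_mem_attainableSet hS hA hR B ht0.le hs.1 hz)
    rw [← hK] at hmem
    simp only [abs_of_nonneg hs.1]
    exact hf _ hmem
  have hgw : ∀ w : ℝ → U, MemLp w 2 (volume.restrict (Set.Icc 0 t)) →
      g (∫ τ in (0 : ℝ)..t, S |t - τ| (b (w τ))) = 0 := by
    intro w hw
    obtain ⟨z, hz⟩ := hB.exists_resolvent_eq hc hJ ht0.le hw
    have h := hgK z ((mem_attainableSet_iff hc hJ B ht0.le).2 ⟨w, hw, hz⟩)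
    rwa [hz] at h
  have horbit : ∀ β : U, ∀ s : ℝ, 0 ≤ s → g (S s (b β)) = 0 := by
    intro β
    have hzero : ∀ s ∈ Set.Icc 0 t, g (S s (b β)) = 0 :=
      fun s hs => functional_eq_zero_of_convolution_eq_zero hS b ht0 hgw β hs
    obtain ⟨y, F, hy, hF, hcov, hlim⟩ := hIII (B β)
    -- Expanding at time t - ν leaves exactly the window [t - ν, t], of length ν, on which g is
    -- known to vanish along the orbit.
    have ht₀ : T < t - ν := by linarith
    have hlim₀ : Tendsto (fun n => ∑ l ∈ F n, R (y l (t - ν))) atTop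
        (𝓝 (S (t - ν) (b β))) := by
      have h1 := (J.continuous.tendsto _).comp
        ((hlim _ _ ht₀ le_rfl).tendsto_at (Set.left_mem_Icc.2 le_rfl))
      rw [semigroupV, extension_resolvent_extendToV (hc _ (by linarith)) hJ] at h1
      refine h1.congr fun n => ?_
      simp only [Function.comp_apply, map_sum, hJ]
    intro s hs
    rcases le_total s t with h | h
    · exact hzero s ⟨hs, h⟩
    · have h1 := functional_orbit_eq_zero hS hA hc hfin hν.le hmin (fun l => hy l _) hF hcov hlim₀
        (g := g) (fun s hs => by
          rw [← hS.apply_add hs.1 (by linarith)]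
          exact hzero _ ⟨by linarith [hs.1], by linarith [hs.2]⟩) (s := s - (t - ν)) (by linarith)
      rwa [← hS.apply_add (by linarith) (by linarith), sub_add_cancel] at h1
  rw [← hg]
  obtain ⟨w, hw, hx⟩ := (mem_attainableSet_iff hc hJ B h₂).1 hx
  change R x = ∫ τ in (0 : ℝ)..t₂, S |t₂ - τ| (b (w τ)) at hx
  rw [hx, ← g.intervalIntegral_comp_comm (intervalIntegrable_convolution hS b h₂ hw)]
  refine (intervalIntegral.integral_congr (g := fun _ => 0) fun s _ => ?_).trans (by simp)
  exact horbit _ _ (abs_nonneg _)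

end AttainableClosure

end AbstractControl

theorem theorem1 {X U : Type*}
    [NormedAddCommGroup X] [NormedSpace ℂ X] [CompleteSpace X]
    [NormedAddCommGroup U] [NormedSpace ℂ U] [CompleteSpace U]
    (S : ℝ → X →L[ℂ] X) (hS : AbstractControl.IsC0Semigroup S)
    (A : X →ₗ.[ℂ] X) (hA : AbstractControl.IsGenerator A S)
    (μ : ℂ) (R : X →L[ℂ] X) (hR : AbstractControl.IsResolventAt A μ R)
    (B : U →L[ℂ] AbstractControl.Extrapolation R)
    (hB : AbstractControl.IsAdmissible R S B) :
    (∀ t₁ t₂ : ℝ, 0 ≤ t₁ → t₁ ≤ t₂ →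
      AbstractControl.attainableSet R S B t₁ ⊆ AbstractControl.attainableSet R S B t₂) ∧
    (∀ T ν : ℝ, 0 ≤ T → 0 < ν →
      AbstractControl.PropertyI A → AbstractControl.PropertyII A →
      AbstractControl.PropertyIII A R S T →
      AbstractControl.IsMinimalOn (AbstractControl.expFamily A) ν →
      ∀ t₁ t₂ : ℝ, T + ν < t₁ → T + ν < t₂ →
        closure (AbstractControl.attainableSet R S B t₁) =
          closure (AbstractControl.attainableSet R S B t₂)) := by
  refine ⟨fun t₁ t₂ h0 h => AbstractControl.attainableSet_mono hS hA hR B h0 h,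
    fun T ν hT hν _ hII hIII hmin t₁ t₂ h₁ h₂ => ?_⟩
  have key : ∀ r s : ℝ, T + ν < r → T + ν < s →
      closure (AbstractControl.attainableSet R S B s) ⊆
        closure (AbstractControl.attainableSet R S B r) := fun r s hr hs =>
    closure_minimal (AbstractControl.attainableSet_subset_closure hS hA hR hB hT hν hII.2.2 hIII
      hmin hr (by linarith)) isClosed_closure
  exact (key t₂ t₁ h₂ h₁).antisymm (key t₁ t₂ h₁ h₂)
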